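/- **Setting.** Let $X$ be a real reflexive Banach space, let $\psi_1,\dots,\psi_n,\Phi:X\to\mathbb R$ be continuous, let $*:[0,\infty)\times X\to X$, $(t,u)\mapsto u_t:=*(t,u)$, be a map, and let $\lambda_1,\dots,\lambda_n,\lambda_\Phi\in\mathbb R$. Let $X^+,X^r\subset X$ be weakly closed sets and $Q:X^+\to X^r$ a map. Put $$J=\sum_{i=1}^n\psi_i,\qquad I=J-\Phi,$$ $$\mathcal P=\Big\{u\in X\setminus\{0\}:\ \sum_{i=1}^n\lambda_i\psi_i(u)=\lambda_\Phi\Phi(u)\Big\},\qquad \mathcal P^+=\mathcal P\cap X^+ .$$ Assume: - $(X_1)$ $\psi_i(u_t)=t^{\lambda_i}\psi_i(u)$ for all $i$, $t\ge 0$, $u\in X$; - $(X_2)$ $\Phi(u_t)=t^{\lambda_\Phi}\Phi(u)$ for all $t\ge0$, $u\in X$; - $(X_3)$ $n\ge1$ and $0<\max\{\lambda_1,\dots,\lambda_n\}<\lambda_\Phi$; - $(X_4)$ $u_0=0$ (that is, $*(0,u)=0$) for all $u\in X$; - $(X_5)$ for each $u\in X$ the map $t\mapsto u_t$ is continuous on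 $[0,\infty)$; - $(X_6)$ $\psi_i(Q(u))\le\psi_i(u)$ for all $u\in X^+$ and all $i$; - $(X_7)$ $\Phi(Q(u))\ge\Phi(u)$ for all $u\in X^+$; - $(X_8)$ if $u\in X^r$, then $u_t\in X^r$ for all $t\ge0$; - $(F_1)$ $\Phi(0)=0$, and $\Phi(u)>0$ for some $u\in X$; - $(F_2)$ $\psi_i(u)\ge0$ for all $i$ and $u$, and $J(u)=0$ if and only if $u=0$; - $(F_3)$ there is $r>0$ such that $\sum_{i=1}^n\lambda_i\psi_i(u)>\lambda_\Phi\Phi(u)$ whenever $0<\|u\|<r$; - $(F_4)$ for every sequence $(u_k)$ in $X$ with $\Phi(u_k)\ge0$ for all $k$: if $J(u_k)\to0$ then $\|u_k\|\to0$, and if $(J(u_k))$ is bounded then $(u_k)$ is bounded; - $(F_5)$ if $(u_k)\subset X^r$ converges weakly to $u$ in $X$, then $\limsup_{k}\Phi(u_k)\le\Phi(u)$; - $(F_6)$ if $(u_k)$ converges weakly to $u$ in $X$, then $\psi_i(u)\le\liminf_{k}\psi_i(u_k)$ for all $i$. In $(X_1)$ at $t=0$, read $0^0=1$ and $0^{\lambda}=0$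 for $\lambda\neq0$. **Theorem.** Suppose that $$\inf_{w\in\mathcal P}I(w)=\inf_{w\in\mathcal P^+}I(w)$$ (infima in $[-\infty,+\infty]$, with $\inf\emptyset=+\infty$). Then there is $u\in\mathcal P$ such that $I(u)=\inf_{w\in\mathcal P}I(w)>0$ and such that, if $I$ is locally Lipschitz, $u$ is a critical point of $I$, that is, $0\in\partial I(u)$. Here $$\partial I(u)=\{\mu\in X^*:\ \langle\mu,v\rangle\le I^0(u,v)\ \ \forall v\in X\},\qquad I^0(u,v)=\limsup_{h\to0,\ s\downarrow0}\frac{I(u+h+sv)-I(u+h)}{s}$$ is Clarke's generalized gradient. -/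

import Mathlib

open Filter Topology Set
open scoped NNReal

/-- A normed space is reflexive if the canonical embedding into its bidual is onto. -/
def IsReflexiveSpace (X : Type*) [NormedAddCommGroup X] [NormedSpace ℝ X] : Prop :=
  Function.Surjective (NormedSpace.inclusionInDoubleDual ℝ X)

/-- The set `S` is closed for the weak topology. -/
def IsWeaklyClosed {X : Type*} [NormedAddCommGroup X] [NormedSpace ℝ X] (S : Set X) : Prop :=
  IsClosed (toWeakSpace ℝ X '' S)

/-- The sequence `u` converges weakly to `w`. -/
def WeaklyConvergesTo {X : Type*} [NormedAddCommGroup X] [NormedSpace ℝ X]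
    (u : ℕ → X) (w : X) : Prop :=
  Tendsto (fun k => toWeakSpace ℝ X (u k)) atTop (𝓝 (toWeakSpace ℝ X w))

/-- `J = ψ₁ + ⋯ + ψₙ`. -/
def functionalJ {X : Type*} {n : ℕ} (ψ : Fin n → X → ℝ) (u : X) : ℝ :=
  ∑ i, ψ i u

/-- `I = J - Φ`. -/
def functionalI {X : Type*} {n : ℕ} (ψ : Fin n → X → ℝ) (Φ : X → ℝ) (u : X) : ℝ :=
  functionalJ ψ u - Φ u

/-- The part of the Pohozaev set lying in `S`; `S = univ` gives the whole Pohozaev set. -/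
def pohozaevSetIn {X : Type*} [Zero X] {n : ℕ} (S : Set X) (ψ : Fin n → X → ℝ) (Φ : X → ℝ)
    (lam : Fin n → ℝ) (lamΦ : ℝ) : Set X :=
  {u | u ∈ S ∧ u ≠ 0 ∧ ∑ i, lam i * ψ i u = lamΦ * Φ u}

/-- The Pohozaev set. -/
def pohozaevSet {X : Type*} [Zero X] {n : ℕ} (ψ : Fin n → X → ℝ) (Φ : X → ℝ)
    (lam : Fin n → ℝ) (lamΦ : ℝ) : Set X :=
  pohozaevSetIn univ ψ Φ lam lamΦ

/-- The infimum of `F` over `S` in the extended reals (so it is `⊤` if `S` is empty). -/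
noncomputable def infOver {X : Type*} (F : X → ℝ) (S : Set X) : EReal :=
  ⨅ w ∈ S, (F w : EReal)

/-- Clarke's generalized directional derivative
`F⁰(u; v) = limsup_{h → 0, s ↓ 0} (F (u + h + s v) - F (u + h)) / s`. -/
noncomputable def clarkeDeriv {X : Type*} [NormedAddCommGroup X] [NormedSpace ℝ X]
    (F : X → ℝ) (u v : X) : EReal :=
  limsup (fun p : X × ℝ => (((F (u + p.1 + p.2 • v) - F (u + p.1)) / p.2 : ℝ) : EReal))
    (𝓝 (0 : X) ×ˢ 𝓝[>] (0 : ℝ))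

/-- Clarke's generalized gradient `∂F(u)`, a subset of the topological dual. -/
def clarkeGradient {X : Type*} [NormedAddCommGroup X] [NormedSpace ℝ X]
    (F : X → ℝ) (u : X) : Set (StrongDual ℝ X) :=
  {μ | ∀ v : X, ((μ v : ℝ) : EReal) ≤ clarkeDeriv F u v}

/-!
The proof minimises `I` over the Pohozaev set by the fibering method and then perturbs one fibre.

*Fibres.* Vanishing of `ψ i` at `0` and continuity of `t ↦ u_t` force `ψ i = 0` whenever
`lam i ≤ 0`, so only positive exponents matter. If `Φ u > 0`, the function `t ↦ I (u_t)` has exactly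
one critical point `t₀ > 0`, which is where the fibre crosses the Pohozaev set; it is the maximum of
`I` on the fibre, and the Pohozaev functional changes sign there. On the Pohozaev set
`I = ∑ i, (1 - lam i / lamΦ) * ψ i`, an increasing function of the `ψ i`. Hence a point `w` with
nonpositive Pohozaev functional and `Φ w > 0` is moved by some `t ≤ 1` onto the Pohozaev set, where
`I` is at most `∑ i, (1 - lam i / lamΦ) * ψ i w` (`FiberingData.exists_scale_mem_le`).

*Existence.* This projection is applied twice: to `Q u_k` for a minimising sequence `u_k` in `X⁺`,
which gives a minimising sequence in `Xʳ`, and to the weak limit of a subsequence of the latter,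
which gives a minimiser. Weak subsequences exist because bounded subsets of a reflexive space are
relatively weakly compact, and a weakly compact set inside a separable subspace is weakly
metrizable (`exists_weaklyConvergesTo_subseq`).

*Criticality.* If some Clarke derivative at the minimiser `w_{t₀}` in direction `v` were negative,
then for small `s > 0` the path `t ↦ w_t + s v`, with `t` near `t₀`, would stay strictly below the
minimum, although by the intermediate value theorem it still crosses the Pohozaev set
(`FiberingData.zero_mem_clarkeGradient`). Neither `u_1 = u` nor joint continuity of the scaling is
needed, since the perturbed path is the fibre of `w` and not that of `w_{t₀}`.
-/

/-! ### Weak sequential compactness in reflexive spaces -/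

/-- The closed linear span of a sequence is separable, so countably many continuous functionals
separate its points. -/
lemma exists_countable_separating_closure_span {X : Type*} [NormedAddCommGroup X]
    [NormedSpace ℝ X] (u : ℕ → X) :
    ∃ f : ℕ → StrongDual ℝ X,
      ∀ x ∈ closure (Submodule.span ℝ (range u) : Set X),
      ∀ y ∈ closure (Submodule.span ℝ (range u) : Set X), (∀ n, f n x = f n y) → x = y := by
  have hsep : TopologicalSpace.IsSeparable (closure (Submodule.span ℝ (range u) : Set X)) :=
    ((countable_range u).isSeparable.span (R := ℝ)).closure
  obtain ⟨c, -, hc, hcY⟩ := hsep.exists_countable_dense_subset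
  have hcne : c.Nonempty := by
    by_contra h
    rw [not_nonempty_iff_eq_empty] at h
    subst h
    have h0 : (0 : X) ∈ closure (Submodule.span ℝ (range u) : Set X) :=
      subset_closure (Submodule.zero_mem _)
    simpa using hcY h0
  obtain ⟨d, rfl⟩ := hc.exists_eq_range hcne
  choose f hf1 hf2 using fun n => exists_dual_vector'' ℝ (d n)
  refine ⟨f, fun x hx y hy hxy => ?_⟩
  have hsub : x - y ∈ closure (range d) := by
    apply hcY
    have := (Submodule.span ℝ (range u)).topologicalClosure.sub_mem
      (x := x) (y := y) hx hy
    exact this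
  rw [← sub_eq_zero, ← norm_eq_zero]
  refine le_antisymm (le_of_forall_pos_le_add fun ε hε => ?_) (norm_nonneg _)
  obtain ⟨_, ⟨n, rfl⟩, hn⟩ := Metric.mem_closure_iff.1 hsub (ε / 2) (half_pos hε)
  rw [dist_eq_norm] at hn
  -- `f n` vanishes at `x - y` and attains the norm of the nearby point `d n`.
  have h1 : ‖d n‖ = f n (d n - (x - y)) := by
    have : f n (d n) = ‖d n‖ := by simpa using hf2 n
    rw [map_sub, map_sub, hxy n, sub_self, sub_zero, this]
  have h2 : f n (d n - (x - y)) ≤ ‖d n - (x - y)‖ := by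
    refine (le_abs_self _).trans (((f n).le_opNorm _).trans ?_)
    exact mul_le_of_le_one_left (norm_nonneg _) (hf1 n)
  have h3 : ‖x - y‖ ≤ ‖x - y - d n‖ + ‖d n‖ := by
    simpa using norm_add_le (x - y - d n) (d n)
  rw [norm_sub_rev] at h2
  linarith

/-- In a reflexive space every bounded sequence has a weakly convergent subsequence. -/
theorem exists_weaklyConvergesTo_subseq {X : Type*} [NormedAddCommGroup X] [NormedSpace ℝ X]
    (hrefl : IsReflexiveSpace X) (u : ℕ → X) (hb : Bornology.IsBounded (range u)) :
    ∃ w, ∃ φ : ℕ → ℕ, StrictMono φ ∧ WeaklyConvergesTo (u ∘ φ) w := by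
  set S : Set (WeakSpace ℝ X) := toWeakSpace ℝ X '' range u with hS
  have hK : IsCompact (closure S) := by
    apply NormedSpace.isCompact_closure_of_isBounded ℝ X S
    · rwa [hS, preimage_image_eq _ (toWeakSpace ℝ X).injective]
    · intro y _
      obtain ⟨x, hx⟩ := hrefl y.toStrongDual
      exact ⟨toWeakSpace ℝ X x, by
        refine DFunLike.ext _ _ fun g => ?_
        exact congrArg (fun F : StrongDual ℝ (StrongDual ℝ X) => F g) hx⟩
  -- The closed span is convex, hence weakly closed, so it contains the weak closure.
  have hKY : closure S ⊆ toWeakSpace ℝ X '' closure (Submodule.span ℝ (range u) : Set X) := by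
    rw [(Submodule.span ℝ (range u)).convex.toWeakSpace_closure ℝ]
    exact closure_mono (image_mono Submodule.subset_span)
  obtain ⟨f, hf⟩ := exists_countable_separating_closure_span u
  have : CompactSpace (closure S) := isCompact_iff_compactSpace.mp hK
  have hmet : TopologicalSpace.MetrizableSpace (closure S) := by
    refine Metric.PiNatEmbed.TopologicalSpace.MetrizableSpace.of_countable_separating
      (fun n (x : closure S) => f n ((toWeakSpace ℝ X).symm x)) (fun n => ?_) fun x y hxy => ?_
    · exact (WeakBilin.eval_continuous (topDualPairing ℝ X).flip (f n)).comp
        continuous_subtype_val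
    · by_contra! h
      obtain ⟨x', hx', hx⟩ := hKY x.2
      obtain ⟨y', hy', hy⟩ := hKY y.2
      refine hxy (Subtype.ext ?_)
      rw [← hx, ← hy, hf x' hx' y' hy' fun n => ?_]
      simpa [← hx, ← hy] using h n
  obtain ⟨w, φ, hφ, hw⟩ := CompactSpace.tendsto_subseq
    (fun k => (⟨toWeakSpace ℝ X (u k), subset_closure ⟨_, mem_range_self k, rfl⟩⟩ : closure S))
  refine ⟨(toWeakSpace ℝ X).symm w, φ, hφ, ?_⟩
  have := (continuous_subtype_val.tendsto w).comp hw
  rw [WeaklyConvergesTo, LinearEquiv.apply_symm_apply]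
  exact this

/-! ### Inequalities between powers -/

/-- The function `s ↦ s ^ l - (l / L) * s ^ L` is largest at `s = 1`. -/
lemma rpow_sub_div_mul_rpow_le {l L s : ℝ} (hl : 0 ≤ l) (hlL : l < L) (hs : 0 ≤ s) :
    s ^ l - l / L * s ^ L ≤ 1 - l / L := by
  have hL : 0 < L := hl.trans_lt hlL
  have hx : 0 ≤ s ^ L := Real.rpow_nonneg hs L
  have h := rpow_one_add_le_one_add_mul_self (s := s ^ L - 1) (p := l / L) (by linarith)
    (by positivity) ((div_le_one hL).2 hlL.le)
  rw [add_sub_cancel, ← Real.rpow_mul hs, mul_div_cancel₀ _ hL.ne'] at h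
  linarith

/-! ### The fibering structure -/

/-- The Pohozaev functional, whose nonzero zeros form the Pohozaev set. -/
def pohozaevFunctional {X : Type*} {n : ℕ} (ψ : Fin n → X → ℝ) (Φ : X → ℝ)
    (lam : Fin n → ℝ) (lamΦ : ℝ) (u : X) : ℝ :=
  ∑ i, lam i * ψ i u - lamΦ * Φ u

/-- The properties of the functionals and of the scaling that govern a single fibre `t ↦ u_t`.
The field `vanish` discards the nonpositive exponents. -/
structure FiberingData {X : Type*} [NormedAddCommGroup X] {n : ℕ}
    (ψ : Fin n → X → ℝ) (Φ : X → ℝ) (scale : ℝ≥0 → X → X) (lam : Fin n → ℝ) (lamΦ M : ℝ) :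
    Prop where
  continuous_ψ : ∀ i, Continuous (ψ i)
  continuous_Φ : Continuous Φ
  ψ_scale : ∀ i t u, ψ i (scale t u) = (t : ℝ) ^ lam i * ψ i u
  Φ_scale : ∀ t u, Φ (scale t u) = (t : ℝ) ^ lamΦ * Φ u
  scale_zero : ∀ u, scale 0 u = 0
  continuous_scale : ∀ u, Continuous fun t => scale t u
  lam_le : ∀ i, lam i ≤ M
  M_pos : 0 < M
  M_lt : M < lamΦ
  vanish : ∀ i, lam i ≤ 0 → ∀ u, ψ i u = 0
  ψ_nonneg : ∀ i u, 0 ≤ ψ i u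
  J_pos : ∀ u, u ≠ 0 → 0 < functionalJ ψ u
  Φ_zero : Φ 0 = 0
  pohozaev_pos : ∃ r > 0, ∀ u : X, 0 < ‖u‖ → ‖u‖ < r → 0 < pohozaevFunctional ψ Φ lam lamΦ u

/-- A functional with nonpositive exponent vanishes: along a fibre it tends to its value `0` at the
origin, whereas `t ^ lam i` stays at least `1` for `t ≤ 1`. -/
lemma eq_zero_of_exponent_nonpos {X : Type*} [NormedAddCommGroup X] {ψ : X → ℝ}
    {scale : ℝ≥0 → X → X} {l : ℝ} (hψ : Continuous ψ)
    (hscale : ∀ t u, ψ (scale t u) = (t : ℝ) ^ l * ψ u) (h0 : ∀ u, scale 0 u = 0)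
    (hc : ∀ u, Continuous fun t => scale t u) (hnn : ∀ u, 0 ≤ ψ u) (hψ0 : ψ 0 = 0)
    (hl : l ≤ 0) (u : X) : ψ u = 0 := by
  refine le_antisymm ?_ (hnn u)
  have ht : Tendsto (fun t : ℝ≥0 => ψ (scale t u)) (𝓝[>] 0) (𝓝 0) := by
    have h := (hψ.comp (hc u)).tendsto (0 : ℝ≥0)
    simp only [Function.comp_apply, h0, hψ0] at h
    exact h.mono_left nhdsWithin_le_nhds
  refine ge_of_tendsto ht ?_
  filter_upwards [Ioo_mem_nhdsGT (zero_lt_one (α := ℝ≥0))] with t ht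
  rw [hscale]
  have h1 : (1 : ℝ) ≤ (t : ℝ) ^ l :=
    Real.one_le_rpow_of_pos_of_le_one_of_nonpos (by exact_mod_cast ht.1)
      (by exact_mod_cast ht.2.le) hl
  exact le_mul_of_one_le_left (hnn u) h1

namespace FiberingData

variable {X : Type*} [NormedAddCommGroup X] {n : ℕ} {ψ : Fin n → X → ℝ} {Φ : X → ℝ}
  {scale : ℝ≥0 → X → X} {lam : Fin n → ℝ} {lamΦ M : ℝ}

lemma lamΦ_pos (h : FiberingData ψ Φ scale lam lamΦ M) : 0 < lamΦ := h.M_pos.trans h.M_lt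

lemma lam_lt (h : FiberingData ψ Φ scale lam lamΦ M) (i : Fin n) : lam i < lamΦ :=
  (h.lam_le i).trans_lt h.M_lt

lemma one_sub_div_pos (h : FiberingData ψ Φ scale lam lamΦ M) (i : Fin n) :
    0 < 1 - lam i / lamΦ :=
  sub_pos.2 ((div_lt_one h.lamΦ_pos).2 (h.lam_lt i))

lemma continuous_pohozaevFunctional (h : FiberingData ψ Φ scale lam lamΦ M) :
    Continuous (pohozaevFunctional ψ Φ lam lamΦ) :=
  (continuous_finsetSum _ fun i _ => (h.continuous_ψ i).const_mul _).sub
    (h.continuous_Φ.const_mul _)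

lemma mem_pohozaevSet_iff {u : X} :
    u ∈ pohozaevSet ψ Φ lam lamΦ ↔ u ≠ 0 ∧ pohozaevFunctional ψ Φ lam lamΦ u = 0 := by
  simp [pohozaevSet, pohozaevSetIn, pohozaevFunctional, sub_eq_zero]

lemma ne_zero_of_pos (h : FiberingData ψ Φ scale lam lamΦ M) {u : X} (hu : 0 < Φ u) : u ≠ 0 := by
  rintro rfl
  exact hu.ne' h.Φ_zero

lemma Φ_scale_pos (h : FiberingData ψ Φ scale lam lamΦ M) {u : X} (hu : 0 < Φ u) {t : ℝ≥0}
    (ht : 0 < t) : 0 < Φ (scale t u) := by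
  rw [h.Φ_scale]
  exact mul_pos (Real.rpow_pos_of_pos (by exact_mod_cast ht) _) hu

lemma exists_ψ_pos (h : FiberingData ψ Φ scale lam lamΦ M) {u : X} (hu : u ≠ 0) :
    ∃ i, 0 < ψ i u := by
  by_contra! hc
  exact absurd (h.J_pos u hu) (not_lt.2 (Finset.sum_nonpos fun i _ => hc i))

lemma lam_pos_of_ψ_pos (h : FiberingData ψ Φ scale lam lamΦ M) {u : X} {i : Fin n}
    (hi : 0 < ψ i u) : 0 < lam i := by
  by_contra! hc
  exact hi.ne' (h.vanish i hc u)

lemma lam_mul_nonneg (h : FiberingData ψ Φ scale lam lamΦ M) (i : Fin n) (u : X) :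
    0 ≤ lam i * ψ i u := by
  rcases (h.ψ_nonneg i u).eq_or_lt with h0 | h0
  · simp [← h0]
  · exact (mul_pos (h.lam_pos_of_ψ_pos h0) h0).le

lemma Φ_pos_of_mem (h : FiberingData ψ Φ scale lam lamΦ M) {u : X}
    (hu : u ∈ pohozaevSet ψ Φ lam lamΦ) : 0 < Φ u := by
  obtain ⟨-, hu0, he⟩ := hu
  obtain ⟨i, hi⟩ := h.exists_ψ_pos hu0
  have : 0 < ∑ i, lam i * ψ i u :=
    Finset.sum_pos' (fun i _ => h.lam_mul_nonneg i u)
      ⟨i, Finset.mem_univ _, mul_pos (h.lam_pos_of_ψ_pos hi) hi⟩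
  rw [he] at this
  exact (mul_pos_iff_of_pos_left h.lamΦ_pos).1 this

/-- On the Pohozaev set `Φ` can be eliminated from `I`. -/
lemma functionalI_eq (h : FiberingData ψ Φ scale lam lamΦ M) {u : X}
    (hu : u ∈ pohozaevSet ψ Φ lam lamΦ) :
    functionalI ψ Φ u = ∑ i, (1 - lam i / lamΦ) * ψ i u := by
  have hΦ : Φ u = ∑ i, lam i / lamΦ * ψ i u := by
    rw [← mul_right_inj' h.lamΦ_pos.ne', ← hu.2.2, Finset.mul_sum]
    refine Finset.sum_congr rfl fun i _ => ?_
    have := h.lamΦ_pos.ne'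
    field_simp
  simp only [functionalI, functionalJ, hΦ, sub_mul, one_mul, Finset.sum_sub_distrib]

lemma mul_functionalJ_le (h : FiberingData ψ Φ scale lam lamΦ M) {u : X}
    (hu : u ∈ pohozaevSet ψ Φ lam lamΦ) :
    (1 - M / lamΦ) * functionalJ ψ u ≤ functionalI ψ Φ u := by
  rw [h.functionalI_eq hu, functionalJ, Finset.mul_sum]
  refine Finset.sum_le_sum fun i _ => mul_le_mul_of_nonneg_right ?_ (h.ψ_nonneg i u)
  have := div_le_div_of_nonneg_right (h.lam_le i) h.lamΦ_pos.le
  linarith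

/-! ### Behaviour along one fibre -/

/-- Values at `t` on a fibre in terms of the values at another point `t₀` of the fibre. -/
lemma ψ_scale_eq (h : FiberingData ψ Φ scale lam lamΦ M) (i : Fin n) (u : X) {t t₀ : ℝ≥0}
    (ht₀ : 0 < t₀) :
    ψ i (scale t u) = ((t / t₀ : ℝ≥0) : ℝ) ^ lam i * ψ i (scale t₀ u) := by
  have : (0 : ℝ) < t₀ := by exact_mod_cast ht₀
  rw [h.ψ_scale, h.ψ_scale, ← mul_assoc, ← Real.mul_rpow (by positivity) (by positivity),
    NNReal.coe_div, div_mul_cancel₀ _ this.ne']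

lemma Φ_scale_eq (h : FiberingData ψ Φ scale lam lamΦ M) (u : X) {t t₀ : ℝ≥0} (ht₀ : 0 < t₀) :
    Φ (scale t u) = ((t / t₀ : ℝ≥0) : ℝ) ^ lamΦ * Φ (scale t₀ u) := by
  have : (0 : ℝ) < t₀ := by exact_mod_cast ht₀
  rw [h.Φ_scale, h.Φ_scale, ← mul_assoc, ← Real.mul_rpow (by positivity) (by positivity),
    NNReal.coe_div, div_mul_cancel₀ _ this.ne']

lemma pohozaevFunctional_scale (h : FiberingData ψ Φ scale lam lamΦ M) {u : X} {t t₀ : ℝ≥0}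
    (ht₀ : 0 < t₀) (hmem : scale t₀ u ∈ pohozaevSet ψ Φ lam lamΦ) :
    pohozaevFunctional ψ Φ lam lamΦ (scale t u) =
      ∑ i, lam i * ψ i (scale t₀ u) *
        (((t / t₀ : ℝ≥0) : ℝ) ^ lam i - ((t / t₀ : ℝ≥0) : ℝ) ^ lamΦ) := by
  rw [pohozaevFunctional, h.Φ_scale_eq u ht₀, mul_left_comm, ← hmem.2.2, Finset.mul_sum,
    ← Finset.sum_sub_distrib]
  refine Finset.sum_congr rfl fun i _ => ?_
  rw [h.ψ_scale_eq i u ht₀]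
  ring

lemma pohozaevFunctional_scale_pos (h : FiberingData ψ Φ scale lam lamΦ M) {u : X} {t t₀ : ℝ≥0}
    (ht : 0 < t) (htt : t < t₀) (hmem : scale t₀ u ∈ pohozaevSet ψ Φ lam lamΦ) :
    0 < pohozaevFunctional ψ Φ lam lamΦ (scale t u) := by
  have ht₀ : 0 < t₀ := ht.trans htt
  have hs0 : (0 : ℝ) < ((t / t₀ : ℝ≥0) : ℝ) := by exact_mod_cast div_pos ht ht₀
  have hs1 : ((t / t₀ : ℝ≥0) : ℝ) < 1 := by exact_mod_cast (div_lt_one ht₀).2 htt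
  rw [h.pohozaevFunctional_scale ht₀ hmem]
  have hlt : ∀ i, ((t / t₀ : ℝ≥0) : ℝ) ^ lamΦ < ((t / t₀ : ℝ≥0) : ℝ) ^ lam i := fun i =>
    Real.rpow_lt_rpow_of_exponent_gt hs0 hs1 (h.lam_lt i)
  obtain ⟨i, hi⟩ := h.exists_ψ_pos hmem.2.1
  exact Finset.sum_pos' (fun i _ => mul_nonneg (h.lam_mul_nonneg i _) (sub_pos.2 (hlt i)).le)
    ⟨i, Finset.mem_univ _, mul_pos (mul_pos (h.lam_pos_of_ψ_pos hi) hi) (sub_pos.2 (hlt i))⟩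

lemma pohozaevFunctional_scale_neg (h : FiberingData ψ Φ scale lam lamΦ M) {u : X} {t t₀ : ℝ≥0}
    (ht₀ : 0 < t₀) (htt : t₀ < t) (hmem : scale t₀ u ∈ pohozaevSet ψ Φ lam lamΦ) :
    pohozaevFunctional ψ Φ lam lamΦ (scale t u) < 0 := by
  have hs1 : 1 < ((t / t₀ : ℝ≥0) : ℝ) := by exact_mod_cast (one_lt_div ht₀).2 htt
  rw [h.pohozaevFunctional_scale ht₀ hmem, ← neg_pos, ← Finset.sum_neg_distrib]
  simp only [← mul_neg, neg_sub]
  have hlt : ∀ i, ((t / t₀ : ℝ≥0) : ℝ) ^ lam i < ((t / t₀ : ℝ≥0) : ℝ) ^ lamΦ := fun i =>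
    Real.rpow_lt_rpow_of_exponent_lt hs1 (h.lam_lt i)
  obtain ⟨i, hi⟩ := h.exists_ψ_pos hmem.2.1
  exact Finset.sum_pos' (fun i _ => mul_nonneg (h.lam_mul_nonneg i _) (sub_pos.2 (hlt i)).le)
    ⟨i, Finset.mem_univ _, mul_pos (mul_pos (h.lam_pos_of_ψ_pos hi) hi) (sub_pos.2 (hlt i))⟩

/-- On a fibre, `I` is largest where the fibre meets the Pohozaev set. -/
lemma functionalI_scale_le (h : FiberingData ψ Φ scale lam lamΦ M) {u : X} {t₀ : ℝ≥0}
    (ht₀ : 0 < t₀) (hmem : scale t₀ u ∈ pohozaevSet ψ Φ lam lamΦ) (t : ℝ≥0) :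
    functionalI ψ Φ (scale t u) ≤ functionalI ψ Φ (scale t₀ u) := by
  have hΦ : Φ (scale t u) =
      ∑ i, lam i / lamΦ * ((t / t₀ : ℝ≥0) : ℝ) ^ lamΦ * ψ i (scale t₀ u) := by
    rw [h.Φ_scale_eq u ht₀, ← mul_right_inj' h.lamΦ_pos.ne', mul_left_comm, ← hmem.2.2,
      Finset.mul_sum, Finset.mul_sum]
    refine Finset.sum_congr rfl fun i _ => ?_
    have := h.lamΦ_pos.ne'
    field_simp
  rw [h.functionalI_eq hmem, functionalI, functionalJ, hΦ, ← Finset.sum_sub_distrib]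
  refine Finset.sum_le_sum fun i _ => ?_
  rw [h.ψ_scale_eq i u ht₀, ← sub_mul]
  rcases (h.ψ_nonneg i (scale t₀ u)).eq_or_lt with h0 | h0
  · simp [← h0]
  · exact mul_le_mul_of_nonneg_right (rpow_sub_div_mul_rpow_le (h.lam_pos_of_ψ_pos h0).le
      (h.lam_lt i) (NNReal.coe_nonneg _)) h0.le

/-- Far out on the fibre of a point with `Φ > 0` the Pohozaev functional is nonpositive. -/
lemma exists_pohozaevFunctional_scale_nonpos (h : FiberingData ψ Φ scale lam lamΦ M) {u : X}
    (hu : 0 < Φ u) : ∃ t : ℝ≥0, 0 < t ∧ pohozaevFunctional ψ Φ lam lamΦ (scale t u) ≤ 0 := by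
  have htop := tendsto_rpow_atTop (sub_pos.2 h.M_lt)
  obtain ⟨t, ht, ht1⟩ := ((htop.eventually_ge_atTop ((∑ i, lam i * ψ i u) / (lamΦ * Φ u))).and
    (eventually_ge_atTop 1)).exists
  have ht0 : 0 < t := zero_lt_one.trans_le ht1
  lift t to ℝ≥0 using ht0.le
  refine ⟨t, by exact_mod_cast ht0, ?_⟩
  rw [div_le_iff₀ (mul_pos h.lamΦ_pos hu)] at ht
  simp only [pohozaevFunctional, h.ψ_scale, h.Φ_scale, sub_nonpos]
  calc ∑ i, lam i * ((t : ℝ) ^ lam i * ψ i u)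
      ≤ ∑ i, (t : ℝ) ^ M * (lam i * ψ i u) := by
        refine Finset.sum_le_sum fun i _ => ?_
        rw [mul_left_comm]
        exact mul_le_mul_of_nonneg_right (Real.rpow_le_rpow_of_exponent_le ht1 (h.lam_le i))
          (h.lam_mul_nonneg i u)
    _ = (t : ℝ) ^ M * ∑ i, lam i * ψ i u := (Finset.mul_sum _ _ _).symm
    _ ≤ (t : ℝ) ^ M * ((t : ℝ) ^ (lamΦ - M) * (lamΦ * Φ u)) :=
        mul_le_mul_of_nonneg_left ht (Real.rpow_nonneg ht0.le _)
    _ = lamΦ * ((t : ℝ) ^ lamΦ * Φ u) := by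
        rw [← mul_assoc, ← Real.rpow_add ht0, add_sub_cancel]
        ring

/-- A point with nonpositive Pohozaev functional and `Φ > 0` is scaled down onto the Pohozaev
set. -/
lemma exists_scale_mem (h : FiberingData ψ Φ scale lam lamΦ M) {u : X} (hu : 0 < Φ u)
    (hP : pohozaevFunctional ψ Φ lam lamΦ u ≤ 0) :
    ∃ t : ℝ≥0, 0 < t ∧ t ≤ 1 ∧ scale t u ∈ pohozaevSet ψ Φ lam lamΦ := by
  obtain ⟨r, hr, hpos⟩ := h.pohozaev_pos
  have hlim : Tendsto (fun t : ℝ≥0 => ‖scale t u‖) (𝓝[>] 0) (𝓝 0) := by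
    have h1 := ((h.continuous_scale u).norm).tendsto 0
    rw [h.scale_zero, norm_zero] at h1
    exact h1.mono_left nhdsWithin_le_nhds
  obtain ⟨t₁, hr₁, ht₁⟩ := ((hlim.eventually_lt_const hr).and
    (Ioo_mem_nhdsGT (zero_lt_one (α := ℝ≥0)))).exists
  have hP₁ := hpos _ (norm_pos_iff.2 (h.ne_zero_of_pos (h.Φ_scale_pos hu ht₁.1))) hr₁
  -- The scaling at `t = 1` need not be the identity, but it preserves all the functionals.
  have hP₂ : pohozaevFunctional ψ Φ lam lamΦ (scale 1 u) ≤ 0 := by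
    simpa [pohozaevFunctional, h.ψ_scale, h.Φ_scale] using hP
  obtain ⟨t, ht, hPt⟩ := intermediate_value_Icc' ht₁.2.le
    (h.continuous_pohozaevFunctional.comp (h.continuous_scale u)).continuousOn ⟨hP₂, hP₁.le⟩
  have ht0 : 0 < t := ht₁.1.trans_le ht.1
  exact ⟨t, ht0, ht.2, mem_pohozaevSet_iff.2 ⟨h.ne_zero_of_pos (h.Φ_scale_pos hu ht0), hPt⟩⟩

lemma pohozaevSet_nonempty (h : FiberingData ψ Φ scale lam lamΦ M) {u : X} (hu : 0 < Φ u) :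
    (pohozaevSet ψ Φ lam lamΦ).Nonempty := by
  obtain ⟨t, ht, hP⟩ := h.exists_pohozaevFunctional_scale_nonpos hu
  obtain ⟨s, -, -, hs⟩ := h.exists_scale_mem (h.Φ_scale_pos hu ht) hP
  exact ⟨_, hs⟩

/-- Projection onto the Pohozaev set along fibres. The numbers `c i` are upper bounds for the
`ψ i u`, such as their values before `Q` is applied or their limits along a sequence converging
weakly to `u`. -/
lemma exists_scale_mem_le (h : FiberingData ψ Φ scale lam lamΦ M) {u : X} (hu : 0 < Φ u)
    {c : Fin n → ℝ} (hc : ∀ i, ψ i u ≤ c i) (hc0 : ∀ i, lam i ≤ 0 → c i = 0)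
    (hcΦ : ∑ i, lam i * c i ≤ lamΦ * Φ u) :
    ∃ t : ℝ≥0, 0 < t ∧ scale t u ∈ pohozaevSet ψ Φ lam lamΦ ∧
      functionalI ψ Φ (scale t u) ≤ ∑ i, (1 - lam i / lamΦ) * c i := by
  have hP : pohozaevFunctional ψ Φ lam lamΦ u ≤ 0 := by
    refine sub_nonpos.2 (le_trans (Finset.sum_le_sum fun i _ => ?_) hcΦ)
    rcases le_or_gt (lam i) 0 with hi | hi
    · rw [h.vanish i hi, hc0 i hi]
    · exact mul_le_mul_of_nonneg_left (hc i) hi.le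
  obtain ⟨t, ht0, ht1, hmem⟩ := h.exists_scale_mem hu hP
  refine ⟨t, ht0, hmem, ?_⟩
  rw [h.functionalI_eq hmem]
  refine Finset.sum_le_sum fun i _ => mul_le_mul_of_nonneg_left ?_ (h.one_sub_div_pos i).le
  rcases le_or_gt (lam i) 0 with hi | hi
  · rw [h.vanish i hi, hc0 i hi]
  · rw [h.ψ_scale]
    exact (mul_le_of_le_one_left (h.ψ_nonneg i u) (Real.rpow_le_one (NNReal.coe_nonneg t)
      (by exact_mod_cast ht1) hi.le)).trans (hc i)

/-! ### Minimisers on the Pohozaev set are critical -/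

/-- A minimiser of `I` on the Pohozaev set is a critical point of `I`, if it is reached by a
fibre. -/
theorem zero_mem_clarkeGradient [NormedSpace ℝ X] (h : FiberingData ψ Φ scale lam lamΦ M) {w : X}
    {t₀ : ℝ≥0} (ht₀ : 0 < t₀) (hmem : scale t₀ w ∈ pohozaevSet ψ Φ lam lamΦ)
    (hmin : ∀ z ∈ pohozaevSet ψ Φ lam lamΦ, functionalI ψ Φ (scale t₀ w) ≤ functionalI ψ Φ z) :
    0 ∈ clarkeGradient (functionalI ψ Φ) (scale t₀ w) := by
  intro v
  by_contra! hneg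
  have hev := eventually_lt_of_limsup_lt hneg
  set u := scale t₀ w
  -- `I` decreases strictly in direction `v`, uniformly near `u`.
  obtain ⟨A, hA, B, hB, hAB⟩ := eventually_prod_iff.1 hev
  have hA' : ∀ᶠ x in 𝓝 u, A (x - u) := by
    have : Tendsto (fun x => x - u) (𝓝 u) (𝓝 0) := by
      simpa using (show Continuous fun x : X => x - u by fun_prop).tendsto u
    exact this.eventually hA
  have hfib := (h.continuous_scale w).tendsto t₀
  have hne : ∀ᶠ p : X × ℝ in 𝓝 u ×ˢ 𝓝 0, p.1 + p.2 • v ≠ 0 := by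
    rw [← nhds_prod_eq]
    refine ContinuousAt.eventually_ne (by fun_prop) ?_
    simpa using hmem.2.1
  obtain ⟨C, hC, D, hD, hCD⟩ := eventually_prod_iff.1 hne
  obtain ⟨a, b, hab, hsub⟩ := (mem_nhds_iff_exists_Ioo_subset' ⟨0, ht₀⟩ ⟨_, lt_add_one t₀⟩).1
    (hfib.eventually (hA'.and hC))
  obtain ⟨t₁, hat₁, ht₁⟩ := exists_between hab.1
  obtain ⟨t₂, ht₂, htb₂⟩ := exists_between hab.2
  have hP₁ := h.pohozaevFunctional_scale_pos (zero_le.trans_lt hat₁) ht₁ hmem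
  have hP₂ := h.pohozaevFunctional_scale_neg ht₀ ht₂ hmem
  have hPc : ∀ x : X, Tendsto (fun s : ℝ => pohozaevFunctional ψ Φ lam lamΦ (x + s • v)) (𝓝[>] 0)
      (𝓝 (pohozaevFunctional ψ Φ lam lamΦ x)) := fun x => by
    have hcont : Continuous fun s : ℝ => pohozaevFunctional ψ Φ lam lamΦ (x + s • v) :=
      h.continuous_pohozaevFunctional.comp (by fun_prop)
    simpa using (hcont.tendsto 0).mono_left (nhdsWithin_le_nhds (s := Ioi 0))
  obtain ⟨s, hBs, hDs, hs₁, hs₂, hs⟩ := (hB.and ((hD.filter_mono nhdsWithin_le_nhds).and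
    (((hPc _).eventually_const_lt hP₁).and (((hPc _).eventually_lt_const hP₂).and
      self_mem_nhdsWithin)))).exists
  obtain ⟨t, ht, hPt⟩ := intermediate_value_Icc' (ht₁.trans ht₂).le
    (f := fun t => pohozaevFunctional ψ Φ lam lamΦ (scale t w + s • v))
    (h.continuous_pohozaevFunctional.comp
      ((h.continuous_scale w).add continuous_const)).continuousOn ⟨hs₂.le, hs₁.le⟩
  obtain ⟨hAt, hCt⟩ := hsub ⟨hat₁.trans_le ht.1, ht.2.trans_lt htb₂⟩
  have hlow := hmin _ (mem_pohozaevSet_iff.2 ⟨hCD hCt hDs, hPt⟩)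
  have hquot := hAB hAt hBs
  simp only [add_sub_cancel, zero_apply] at hquot
  rw [EReal.coe_lt_coe_iff, div_neg_iff] at hquot
  have hfibre := h.functionalI_scale_le ht₀ hmem t
  have hs' : (0 : ℝ) < s := hs
  rcases hquot with hq | hq <;> linarith [hq.1, hq.2]

/-! ### Existence of minimisers -/

/-- `J` is bounded away from `0` on the Pohozaev set, because small `J` would mean small norm. By
`mul_functionalJ_le` so is `I`. -/
lemma exists_pos_le_functionalJ (h : FiberingData ψ Φ scale lam lamΦ M)
    (hJ : ∀ u : ℕ → X, (∀ k, 0 ≤ Φ (u k)) → Tendsto (fun k => functionalJ ψ (u k)) atTop (𝓝 0) →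
      Tendsto (fun k => ‖u k‖) atTop (𝓝 0)) :
    ∃ δ > 0, ∀ u ∈ pohozaevSet ψ Φ lam lamΦ, δ ≤ functionalJ ψ u := by
  by_contra! hcon
  choose u hu hlt using fun k : ℕ => hcon (1 / ((k : ℝ) + 1)) Nat.one_div_pos_of_nat
  have hlim := hJ u (fun k => (h.Φ_pos_of_mem (hu k)).le)
    (squeeze_zero (fun k => Finset.sum_nonneg fun i _ => h.ψ_nonneg i _) (fun k => (hlt k).le)
      tendsto_one_div_add_atTop_nhds_zero_nat)
  obtain ⟨r, hr, hpos⟩ := h.pohozaev_pos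
  obtain ⟨k, hk⟩ := (hlim.eventually_lt_const hr).exists
  have := hpos _ (norm_pos_iff.2 (hu k).2.1) hk
  rw [(mem_pohozaevSet_iff.1 (hu k)).2] at this
  exact this.false

/-- A sequence in `Xr` and in the Pohozaev set with `I (u k) ≤ m + 1 / (k + 1)` has a subsequence
with a weak limit `w` whose fibre meets the Pohozaev set at a point with `I ≤ m`. The weak limit
itself may lie off the Pohozaev set, because `Φ` and the `ψ i` are only semicontinuous. -/
theorem exists_scale_mem_le_of_tendsto [NormedSpace ℝ X] (h : FiberingData ψ Φ scale lam lamΦ M)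
    (hrefl : IsReflexiveSpace X) {Xr : Set X}
    (hJ : ∀ u : ℕ → X, (∀ k, 0 ≤ Φ (u k)) →
      Bornology.IsBounded (range fun k => functionalJ ψ (u k)) → Bornology.IsBounded (range u))
    (hΦ : ∀ (u : ℕ → X) (w : X), (∀ k, u k ∈ Xr) → WeaklyConvergesTo u w →
      limsup (fun k => (Φ (u k) : EReal)) atTop ≤ (Φ w : EReal))
    (hψ : ∀ (u : ℕ → X) (w : X), WeaklyConvergesTo u w →
      ∀ i, (ψ i w : EReal) ≤ liminf (fun k => (ψ i (u k) : EReal)) atTop)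
    {δ : ℝ} (hδ : 0 < δ) (hδJ : ∀ u ∈ pohozaevSet ψ Φ lam lamΦ, δ ≤ functionalJ ψ u)
    {u : ℕ → X} (hu : ∀ k, u k ∈ pohozaevSet ψ Φ lam lamΦ) (hur : ∀ k, u k ∈ Xr)
    {m : ℝ} (hm : ∀ k : ℕ, functionalI ψ Φ (u k) ≤ m + 1 / ((k : ℝ) + 1)) :
    ∃ (w : X) (t : ℝ≥0), 0 < t ∧ scale t w ∈ pohozaevSet ψ Φ lam lamΦ ∧
      functionalI ψ Φ (scale t w) ≤ m := by
  have hκ : 0 < 1 - M / lamΦ := sub_pos.2 ((div_lt_one h.lamΦ_pos).2 h.M_lt)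
  set B := (m + 1) / (1 - M / lamΦ)
  have hJB : ∀ k, functionalJ ψ (u k) ≤ B := fun k => by
    rw [le_div_iff₀' hκ]
    refine (h.mul_functionalJ_le (hu k)).trans ((hm k).trans ?_)
    have : (1 : ℝ) / ((k : ℝ) + 1) ≤ 1 := by
      rw [div_le_one (by positivity)]
      linarith [(Nat.cast_nonneg k : (0 : ℝ) ≤ k)]
    linarith
  have hJ0 : ∀ k, 0 ≤ functionalJ ψ (u k) := fun k => Finset.sum_nonneg fun i _ => h.ψ_nonneg i _
  have hbdd : Bornology.IsBounded (range u) := by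
    refine hJ u (fun k => (h.Φ_pos_of_mem (hu k)).le) ((Metric.isBounded_Icc 0 B).subset ?_)
    rintro _ ⟨k, rfl⟩
    exact ⟨hJ0 k, hJB k⟩
  obtain ⟨w, φ, hφ, hw⟩ := exists_weaklyConvergesTo_subseq hrefl u hbdd
  -- A further subsequence makes all the `ψ i` converge, and with them `Φ` and `I`.
  obtain ⟨c, -, θ, hθ, hc⟩ := (isCompact_Icc (a := (0 : Fin n → ℝ))
    (b := fun _ => B)).tendsto_subseq (x := fun k i => ψ i (u (φ k)))
    (fun k => ⟨fun i => h.ψ_nonneg i _, fun i => (Finset.single_le_sum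
      (fun j _ => h.ψ_nonneg j (u (φ k))) (Finset.mem_univ i)).trans (hJB (φ k))⟩)
  set y : ℕ → X := fun k => u (φ (θ k))
  have hyP : ∀ k, y k ∈ pohozaevSet ψ Φ lam lamΦ := fun k => hu _
  have hyw : WeaklyConvergesTo y w := by
    have h1 : Tendsto (fun k => toWeakSpace ℝ X ((u ∘ φ) k)) atTop (𝓝 (toWeakSpace ℝ X w)) := hw
    exact h1.comp hθ.tendsto_atTop
  have hci : ∀ i, Tendsto (fun k => ψ i (y k)) atTop (𝓝 (c i)) := fun i =>
    (tendsto_pi_nhds.1 hc) i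
  have hwc : ∀ i, ψ i w ≤ c i := fun i => by
    have h1 := hψ y w hyw i
    rw [(EReal.tendsto_coe.2 (hci i)).liminf_eq] at h1
    exact_mod_cast h1
  have hc0 : ∀ i, lam i ≤ 0 → c i = 0 := fun i hi => by
    have h1 := hci i
    simp only [h.vanish i hi] at h1
    exact tendsto_nhds_unique h1 tendsto_const_nhds
  have hcnn : ∀ i, 0 ≤ c i := fun i => ge_of_tendsto' (hci i) fun k => h.ψ_nonneg i _
  have hΦy : Tendsto (fun k => Φ (y k)) atTop (𝓝 ((∑ i, lam i * c i) / lamΦ)) := by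
    have h1 : (fun k => Φ (y k)) = fun k => (∑ i, lam i * ψ i (y k)) / lamΦ := by
      funext k
      rw [(hyP k).2.2, mul_div_cancel_left₀ _ h.lamΦ_pos.ne']
    rw [h1]
    exact (tendsto_finsetSum _ fun i _ => (hci i).const_mul _).div_const _
  have hΦw : (∑ i, lam i * c i) / lamΦ ≤ Φ w := by
    have h1 := hΦ y w (fun k => hur _) hyw
    rw [(EReal.tendsto_coe.2 hΦy).limsup_eq] at h1
    exact_mod_cast h1
  -- The lower bound on `J` survives in the limit and keeps `Φ w` positive.
  have hcpos : 0 < ∑ i, lam i * c i := by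
    have h1 : δ ≤ ∑ i, c i :=
      ge_of_tendsto' (tendsto_finsetSum _ fun i _ => hci i) fun k => hδJ _ (hyP k)
    obtain ⟨i, -, hi⟩ : ∃ i ∈ Finset.univ, 0 < c i := by
      by_contra! hcon
      linarith [Finset.sum_nonpos hcon]
    have hlam : ∀ i, 0 < c i → 0 < lam i := fun i hi => by
      by_contra! hcon
      exact hi.ne' (hc0 i hcon)
    refine Finset.sum_pos' (fun j _ => ?_) ⟨i, Finset.mem_univ _, mul_pos (hlam i hi) hi⟩
    rcases (hcnn j).eq_or_lt with h0 | h0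
    · simp [← h0]
    · exact (mul_pos (hlam j h0) h0).le
  obtain ⟨t, ht, hmem, hle⟩ := h.exists_scale_mem_le
    ((div_pos hcpos h.lamΦ_pos).trans_le hΦw) hwc hc0 ((div_le_iff₀' h.lamΦ_pos).1 hΦw)
  refine ⟨w, t, ht, hmem, hle.trans ?_⟩
  have hI : Tendsto (fun k => functionalI ψ Φ (y k)) atTop
      (𝓝 (∑ i, (1 - lam i / lamΦ) * c i)) := by
    simp only [fun k => h.functionalI_eq (hyP k)]
    exact tendsto_finsetSum _ fun i _ => (hci i).const_mul _
  have hbound : Tendsto (fun k : ℕ => m + 1 / (((φ (θ k) : ℕ) : ℝ) + 1)) atTop (𝓝 m) := by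
    simpa using (tendsto_one_div_add_atTop_nhds_zero_nat.comp
      (hφ.tendsto_atTop.comp hθ.tendsto_atTop)).const_add m
  exact le_of_tendsto_of_tendsto' hI hbound fun k => hm _

end FiberingData

theorem theorem1p1 {X : Type*} [NormedAddCommGroup X] [NormedSpace ℝ X] [CompleteSpace X]
    (hrefl : IsReflexiveSpace X)
    {n : ℕ} (ψ : Fin n → X → ℝ) (Φ : X → ℝ)
    (hψ : ∀ i, Continuous (ψ i)) (hΦ : Continuous Φ)
    -- the scaling map `(t, u) ↦ u_t`, for `t ≥ 0`
    (scale : ℝ≥0 → X → X) (lam : Fin n → ℝ) (lamΦ : ℝ)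
    (X1 : ∀ i t u, ψ i (scale t u) = (t : ℝ) ^ lam i * ψ i u)
    (X2 : ∀ t u, Φ (scale t u) = (t : ℝ) ^ lamΦ * Φ u)
    (X3 : ∃ M, IsGreatest (range lam) M ∧ 0 < M ∧ M < lamΦ)
    (X4 : ∀ u, scale 0 u = 0)
    (X5 : ∀ u, Continuous fun t => scale t u)
    (Xplus Xr : Set X) (hXplus : IsWeaklyClosed Xplus) (hXr : IsWeaklyClosed Xr)
    (Q : Xplus → Xr)
    (X6 : ∀ (u : Xplus) i, ψ i (Q u) ≤ ψ i u)
    (X7 : ∀ u : Xplus, Φ u ≤ Φ (Q u))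
    (X8 : ∀ u ∈ Xr, ∀ t, scale t u ∈ Xr)
    (F1 : Φ 0 = 0 ∧ ∃ u, 0 < Φ u)
    (F2 : (∀ i u, 0 ≤ ψ i u) ∧ ∀ u, functionalJ ψ u = 0 ↔ u = 0)
    (F3 : ∃ r > 0, ∀ u : X, 0 < ‖u‖ → ‖u‖ < r → lamΦ * Φ u < ∑ i, lam i * ψ i u)
    (F4 : ∀ u : ℕ → X, (∀ k, 0 ≤ Φ (u k)) →
      (Tendsto (fun k => functionalJ ψ (u k)) atTop (𝓝 0) →
        Tendsto (fun k => ‖u k‖) atTop (𝓝 0)) ∧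
      (Bornology.IsBounded (range fun k => functionalJ ψ (u k)) →
        Bornology.IsBounded (range u)))
    (F5 : ∀ (u : ℕ → X) (w : X), (∀ k, u k ∈ Xr) → WeaklyConvergesTo u w →
      limsup (fun k => (Φ (u k) : EReal)) atTop ≤ (Φ w : EReal))
    (F6 : ∀ (u : ℕ → X) (w : X), WeaklyConvergesTo u w →
      ∀ i, (ψ i w : EReal) ≤ liminf (fun k => (ψ i (u k) : EReal)) atTop)
    (hinf : infOver (functionalI ψ Φ) (pohozaevSet ψ Φ lam lamΦ) =
      infOver (functionalI ψ Φ) (pohozaevSetIn Xplus ψ Φ lam lamΦ)) :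
    ∃ u ∈ pohozaevSet ψ Φ lam lamΦ,
      (functionalI ψ Φ u : EReal) = infOver (functionalI ψ Φ) (pohozaevSet ψ Φ lam lamΦ) ∧
      0 < infOver (functionalI ψ Φ) (pohozaevSet ψ Φ lam lamΦ) ∧
      (LocallyLipschitz (functionalI ψ Φ) → 0 ∈ clarkeGradient (functionalI ψ Φ) u) := by
  obtain ⟨M, ⟨-, hMub⟩, hM0, hML⟩ := X3
  have hJ0 : functionalJ ψ 0 = 0 := (F2.2 0).2 rfl
  have hψ0 : ∀ i, ψ i 0 = 0 := fun i =>
    (Finset.sum_eq_zero_iff_of_nonneg fun j _ => F2.1 j 0).1 hJ0 i (Finset.mem_univ i)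
  have h : FiberingData ψ Φ scale lam lamΦ M :=
    { continuous_ψ := hψ
      continuous_Φ := hΦ
      ψ_scale := X1
      Φ_scale := X2
      scale_zero := X4
      continuous_scale := X5
      lam_le := fun i => hMub (mem_range_self i)
      M_pos := hM0
      M_lt := hML
      vanish := fun i hi =>
        eq_zero_of_exponent_nonpos (hψ i) (X1 i) X4 X5 (F2.1 i) (hψ0 i) hi
      ψ_nonneg := F2.1
      J_pos := fun u hu => lt_of_le_of_ne (Finset.sum_nonneg fun i _ => F2.1 i u)
        fun he => hu ((F2.2 u).1 he.symm)
      Φ_zero := F1.1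
      pohozaev_pos := by
        obtain ⟨r, hr, hF⟩ := F3
        exact ⟨r, hr, fun u h1 h2 => sub_pos.2 (hF u h1 h2)⟩ }
  obtain ⟨u₀, hu₀⟩ := F1.2
  obtain ⟨p, hp⟩ := h.pohozaevSet_nonempty hu₀
  obtain ⟨δ, hδ, hδJ⟩ := h.exists_pos_le_functionalJ fun u hu => (F4 u hu).1
  have hκ : 0 < 1 - M / lamΦ := sub_pos.2 ((div_lt_one h.lamΦ_pos).2 hML)
  have hlow : (((1 - M / lamΦ) * δ : ℝ) : EReal) ≤
      infOver (functionalI ψ Φ) (pohozaevSet ψ Φ lam lamΦ) :=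
    le_iInf₂ fun u hu => EReal.coe_le_coe_iff.2
      ((mul_le_mul_of_nonneg_left (hδJ u hu) hκ.le).trans (h.mul_functionalJ_le hu))
  have hpos : 0 < infOver (functionalI ψ Φ) (pohozaevSet ψ Φ lam lamΦ) :=
    lt_of_lt_of_le (EReal.coe_pos.2 (mul_pos hκ hδ)) hlow
  have hlt : infOver (functionalI ψ Φ) (pohozaevSet ψ Φ lam lamΦ) < ⊤ :=
    (iInf₂_le p hp).trans_lt (EReal.coe_lt_top _)
  obtain ⟨m, hm⟩ : ∃ m : ℝ,
      (m : EReal) = infOver (functionalI ψ Φ) (pohozaevSet ψ Φ lam lamΦ) :=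
    ⟨_, EReal.coe_toReal hlt.ne (EReal.bot_lt_zero.trans hpos).ne'⟩
  have hmin : ∀ z ∈ pohozaevSet ψ Φ lam lamΦ, m ≤ functionalI ψ Φ z := fun z hz => by
    rw [← EReal.coe_le_coe_iff, hm]
    exact iInf₂_le z hz
  have hseq : ∀ k : ℕ, ∃ w ∈ pohozaevSet ψ Φ lam lamΦ, w ∈ Xr ∧
      functionalI ψ Φ w ≤ m + 1 / ((k : ℝ) + 1) := by
    intro k
    have hk : infOver (functionalI ψ Φ) (pohozaevSetIn Xplus ψ Φ lam lamΦ) <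
        ((m + 1 / ((k : ℝ) + 1) : ℝ) : EReal) := by
      rw [← hinf, ← hm, EReal.coe_lt_coe_iff]
      exact lt_add_of_pos_right _ Nat.one_div_pos_of_nat
    simp only [infOver, iInf_lt_iff, EReal.coe_lt_coe_iff] at hk
    obtain ⟨u, hu, hIu⟩ := hk
    have huP : u ∈ pohozaevSet ψ Φ lam lamΦ := ⟨mem_univ _, hu.2⟩
    obtain ⟨t, -, hmem, hle⟩ := h.exists_scale_mem_le (u := Q ⟨u, hu.1⟩) (c := fun i => ψ i u)
      ((h.Φ_pos_of_mem huP).trans_le (X7 ⟨u, hu.1⟩)) (X6 ⟨u, hu.1⟩)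
      (fun i hi => h.vanish i hi u)
      (hu.2.2.le.trans (mul_le_mul_of_nonneg_left (X7 ⟨u, hu.1⟩) h.lamΦ_pos.le))
    rw [← h.functionalI_eq huP] at hle
    exact ⟨_, hmem, X8 _ (Q ⟨u, hu.1⟩).2 t, hle.trans hIu.le⟩
  choose u huP hur hum using hseq
  obtain ⟨w, t, ht, hmem, hle⟩ := h.exists_scale_mem_le_of_tendsto hrefl
    (fun u hu => (F4 u hu).2) F5 F6 hδ hδJ huP hur hum
  refine ⟨scale t w, hmem, ?_, hpos, fun _ => ?_⟩
  · rw [← hm, EReal.coe_eq_coe_iff]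
    exact le_antisymm hle (hmin _ hmem)
  · exact h.zero_mem_clarkeGradient ht hmem fun z hz => hle.trans (hmin z hz)
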